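/- Let $k$ be a field, $R=k[x_1,\ldots,x_n]$, $\mathfrak m=(x_1,\ldots,x_n)$, and let $I\subsetneq R$ be a proper ideal (not necessarily homogeneous). For an $R$-module $M$ put $\operatorname{depth} M=\min\{d\ge 0 \mid \operatorname{Ext}^d_R(R/\mathfrak m,M)\neq 0\}$, with $\operatorname{depth} M=\infty$ if all these Ext modules vanish. For a term order $>$ and an ideal $J\subseteq R$ let $\operatorname{in}_>(J)$ be the ideal generated by the leading terms of the elements of $J$. An element $f$ is called regular on $M$ if $f\in\mathfrak m$ and $f$ is a non-zerodivisor on $M$. Let $>_1,\ldots,>_q$ be term orders on $R$. A sequence of nonconstant polynomials $f_1,\ldots,f_q\in R$ is called an initially regular sequence on $R/I$ with respect to $>_1,\ldots,>_q$ if, for each $i=1,\ldots,q$, $f_i$ is a regular element on $R/I_i$, where $I_1=\operatorname{in}_{>_1}(I)$ and $I_i=\operatorname{in}_{>_i}(I_{i-1},f_{i-1})$ for $2\le i\le q$. If $f_1,\ldots,f_q$ is an initially regular sequence on $R/I$ with respect to $>_1,\ldots,>_q$, then $\operatorname{depth} R/I\ge q$. -/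

import Mathlib

universe u v

open CategoryTheory in
/-- The depth `min {d | Ext^d_A(A/𝔪, M) ≠ 0}` of an `A`-module `M` with respect to an ideal `𝔪`
of `A`. It is an element of `ℕ∞`, equal to `⊤` if all the Ext modules vanish. -/
noncomputable def moduleDepth {A : Type u} [CommRing A] (𝔪 : Ideal A)
    (M : Type u) [AddCommGroup M] [Module A M] : ℕ∞ :=
  sInf {e : ℕ∞ | ∃ d : ℕ, e = d ∧
    Nontrivial (Abelian.Ext.{u} (ModuleCat.of A (A ⧸ 𝔪)) (ModuleCat.of A M) d)}

namespace InitiallyRegular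

open MvPolynomial

variable {k : Type u} [Field k] {n : ℕ}

/-- The initial ideal of `I` for a term order: the ideal generated by the leading terms of all
elements of `I` (the leading term of `0` is `0`). -/
noncomputable def ini (ord : MonomialOrder.{0, v} (Fin n)) (I : Ideal (MvPolynomial (Fin n) k)) :
    Ideal (MvPolynomial (Fin n) k) :=
  Ideal.span (ord.leadingTerm '' (I : Set (MvPolynomial (Fin n) k)))

/-- `f` is a regular element on the module `M`, i.e. a regular sequence of length one: as for all
regular sequences in the definition of depth, it is required to lie in the maximal homogeneous
ideal `(x₁, …, xₙ)`, and it is a non-zerodivisor on `M`. -/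
def IsRegularElement (f : MvPolynomial (Fin n) k) (M : Type u) [AddCommGroup M]
    [Module (MvPolynomial (Fin n) k) M] : Prop :=
  f ∈ idealOfVars (Fin n) k ∧ IsSMulRegular M f

/-- The ideals attached to `I`, the term orders and the polynomials `f`, with indices shifted to
start at `0`: the first one is the initial ideal of `I` for the first order, and the `(i + 1)`-st
one is the initial ideal, for the `(i + 1)`-st order, of the ideal generated by the `i`-th one
and `f i`. -/
noncomputable def iniSeq {q : ℕ} (I : Ideal (MvPolynomial (Fin n) k))
    (ord : Fin q → MonomialOrder.{0, v} (Fin n)) (f : Fin q → MvPolynomial (Fin n) k) :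
    (i : ℕ) → i < q → Ideal (MvPolynomial (Fin n) k)
  | 0, h => ini (ord ⟨0, h⟩) I
  | i + 1, h => ini (ord ⟨i + 1, h⟩)
      (iniSeq I ord f i (Nat.lt_of_succ_lt h) ⊔ Ideal.span {f ⟨i, Nat.lt_of_succ_lt h⟩})

/-- `f` is an initially regular sequence on `k[x₁, …, xₙ] / I` with respect to the sequence `ord`
of term orders. -/
structure IsInitiallyRegular {q : ℕ} (I : Ideal (MvPolynomial (Fin n) k))
    (ord : Fin q → MonomialOrder.{0, v} (Fin n)) (f : Fin q → MvPolynomial (Fin n) k) : Prop where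
  proper : I ≠ ⊤
  nonconstant : ∀ i, ∀ c : k, f i ≠ C c
  regular : ∀ i : Fin q,
    IsRegularElement (f i) (MvPolynomial (Fin n) k ⧸ iniSeq I ord f i i.isLt)

end InitiallyRegular

/-!
Depth does not drop when `ini ord I` is replaced by `I`: if `Ext^i(R/𝔪, R/in(I))` vanishes, then so
does `Ext^i(R/𝔪, R/I)`. Indeed `R/𝔪` has a free resolution by matrices which are homogeneous for
the grading by exponent vectors. Given a cocycle modulo `I`, its component of largest multidegree
for the term order is a cocycle modulo `in(I)`, hence a coboundary up to leading terms of elements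
of `I`; subtracting the coboundary and these elements lowers the largest multidegree, and a term
order is a well-order. On the other hand, killing a regular element of `𝔪` drops the depth by at
least one, so the depth of `R/I` is at least the number of steps of the sequence.
-/

section Ext

open CategoryTheory Abelian Function

variable {R : Type u} [CommRing R]

theorem natCast_le_moduleDepth_iff {𝔪 : Ideal R} {M : Type u} [AddCommGroup M] [Module R M]
    {q : ℕ} : q ≤ moduleDepth 𝔪 M ↔
      ∀ d < q, Subsingleton (Ext.{u} (ModuleCat.of R (R ⧸ 𝔪)) (ModuleCat.of R M) d) := by
  simp only [moduleDepth, le_sInf_iff, Set.mem_ofPred_eq, forall_exists_index, and_imp,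
    ← not_nontrivial_iff_subsingleton]
  refine ⟨fun h d hd hnt => ?_, ?_⟩
  · exact (Nat.cast_le.1 (h _ d rfl hnt)).not_gt hd
  · rintro h _ d rfl hnt
    exact Nat.cast_le.2 (not_lt.1 fun hd => h d hd hnt)

section Regular

variable {N M Q : Type u} [AddCommGroup N] [Module R N] [AddCommGroup M] [Module R M]
  [AddCommGroup Q] [Module R Q] {f : R} {g : M →ₗ[R] Q}

theorem subsingleton_ext_zero_of_isSMulRegular (hN : f ∈ Module.annihilator R N)
    (hf : IsSMulRegular M f) :
    Subsingleton (Ext.{u} (ModuleCat.of R N) (ModuleCat.of R M) 0) := by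
  have : Subsingleton (N →ₗ[R] M) := by
    refine subsingleton_of_forall_eq 0 fun φ => LinearMap.ext fun y => hf ?_
    simp [← map_smul, Module.mem_annihilator.1 hN y]
  exact (Ext.addEquiv₀.trans ModuleCat.homAddEquiv).subsingleton

theorem subsingleton_ext_succ_of_isSMulRegular (hN : f ∈ Module.annihilator R N)
    (hf : IsSMulRegular M f) (hg : Surjective g) (hfg : Exact (LinearMap.lsmul R M f) g) {i : ℕ}
    (hQ : Subsingleton (Ext.{u} (ModuleCat.of R N) (ModuleCat.of R Q) i)) :
    Subsingleton (Ext.{u} (ModuleCat.of R N) (ModuleCat.of R M) (i + 1)) := by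
  have hS : (ModuleCat.shortComplexOfCompEqZero _ _ hfg.linearMap_comp_eq_zero).ShortExact :=
    ModuleCat.shortComplex_shortExact _ hfg hf hg
  have hfN : f • 𝟙 (ModuleCat.of R N) = 0 := by
    ext y; exact Module.mem_annihilator.1 hN y
  refine subsingleton_of_forall_eq 0 fun e => ?_
  have he : f • e = 0 := by
    rw [← Ext.mk₀_id_comp e, ← Ext.smul_comp, ← Ext.mk₀_smul, hfN, Ext.mk₀_zero, Ext.zero_comp]
  rw [Ext.smul_eq_comp_mk₀] at he
  obtain ⟨e', rfl⟩ := Ext.covariant_sequence_exact₁ _ hS e he rfl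
  obtain rfl : e' = 0 := hQ.elim e' 0
  exact Ext.zero_comp ..

end Regular

theorem moduleDepth_add_one_le {𝔪 : Ideal R} {M Q : Type u} [AddCommGroup M] [Module R M]
    [AddCommGroup Q] [Module R Q] {f : R} {g : M →ₗ[R] Q} (hf𝔪 : f ∈ 𝔪) (hf : IsSMulRegular M f)
    (hg : Surjective g) (hfg : Exact (LinearMap.lsmul R M f) g) :
    moduleDepth 𝔪 Q + 1 ≤ moduleDepth 𝔪 M := by
  have hann : f ∈ Module.annihilator R (R ⧸ 𝔪) := by rwa [Ideal.annihilator_quotient]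
  refine ENat.forall_natCast_le_iff_le.1 fun q hq => natCast_le_moduleDepth_iff.2 fun d hd => ?_
  cases d with
  | zero => exact subsingleton_ext_zero_of_isSMulRegular hann hf
  | succ d =>
    refine subsingleton_ext_succ_of_isSMulRegular hann hf hg hfg ?_
    refine (natCast_le_moduleDepth_iff (q := d + 1)).1 ?_ d d.lt_succ_self
    have : ((d + 1 : ℕ) : ℕ∞) + 1 ≤ moduleDepth 𝔪 Q + 1 :=
      le_trans (by exact_mod_cast hd) hq
    exact (ENat.add_le_add_iff_right ENat.one_ne_top).1 this

theorem exact_lsmul_factor_sup_span (J : Ideal R) (f : R) :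
    Exact (LinearMap.lsmul R (R ⧸ J) f)
      (Submodule.factor (le_sup_left : J ≤ J ⊔ Ideal.span {f})) := by
  intro y
  obtain ⟨r, rfl⟩ := Submodule.mkQ_surjective J y
  have hr : r ∈ J ⊔ Ideal.span {f} ↔ ∃ a, f * a - r ∈ J := by
    simp only [sup_comm J, Ideal.mem_span_singleton_sup]
    refine ⟨?_, fun ⟨a, ha⟩ => ⟨a, _, J.neg_mem ha, by ring⟩⟩
    rintro ⟨a, b, hb, rfl⟩
    exact ⟨a, by convert J.neg_mem hb using 1; ring⟩
  refine (Submodule.Quotient.mk_eq_zero _).trans (hr.trans ?_)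
  simp only [Submodule.mkQ_apply, Set.mem_range, (Submodule.mkQ_surjective J).exists,
    LinearMap.lsmul_apply, ← Submodule.Quotient.mk_smul, Submodule.Quotient.eq, smul_eq_mul]

theorem moduleDepth_quotient_sup_span_add_one_le {𝔪 J : Ideal R} {f : R} (hf𝔪 : f ∈ 𝔪)
    (hf : IsSMulRegular (R ⧸ J) f) :
    moduleDepth 𝔪 (R ⧸ J ⊔ Ideal.span {f}) + 1 ≤ moduleDepth 𝔪 (R ⧸ J) :=
  moduleDepth_add_one_le hf𝔪 hf (Submodule.factor_surjective le_sup_left)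
    (exact_lsmul_factor_sup_span J f)

section Presentation

variable {F₀ F₁ F₂ N M : Type u} [AddCommGroup F₀] [Module R F₀] [AddCommGroup F₁] [Module R F₁]
  [AddCommGroup F₂] [Module R F₂] [AddCommGroup N] [Module R N] [AddCommGroup M] [Module R M]
  {p : F₀ →ₗ[R] N} {d₁ : F₁ →ₗ[R] F₀} {d₂ : F₂ →ₗ[R] F₁}

theorem subsingleton_ext_zero_iff_of_exact (hp : Surjective p) (hd : Exact d₁ p) :
    Subsingleton (Ext.{u} (ModuleCat.of R N) (ModuleCat.of R M) 0) ↔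
      ∀ φ : F₀ →ₗ[R] M, φ ∘ₗ d₁ = 0 → φ = 0 := by
  rw [(Ext.addEquiv₀.trans ModuleCat.homAddEquiv).toEquiv.subsingleton_congr]
  refine ⟨fun h φ hφ => ?_, fun h => subsingleton_of_forall_eq 0 fun ψ => ?_⟩
  · obtain ⟨ψ, rfl⟩ := (LinearMap.exact_lcomp_of_exact_of_surjective M hd hp φ).1 hφ
    rw [h.elim ψ 0, map_zero]
  · refine (LinearMap.cancel_right hp).1 ?_
    rw [LinearMap.zero_comp]
    exact h _ (by rw [LinearMap.comp_assoc, hd.linearMap_comp_eq_zero, LinearMap.comp_zero])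

variable [Module.Projective R F₀]

theorem subsingleton_ext_one_iff_of_projective (hp : Surjective p) :
    Subsingleton (Ext.{u} (ModuleCat.of R N) (ModuleCat.of R M) 1) ↔
      ∀ φ : LinearMap.ker p →ₗ[R] M, ∃ ψ : F₀ →ₗ[R] M, ψ ∘ₗ (LinearMap.ker p).subtype = φ := by
  have hS := LinearMap.shortExact_shortComplexKer hp
  refine ⟨fun h φ => ?_, fun h => subsingleton_of_forall_eq 0 fun e => ?_⟩
  · obtain ⟨x, hx⟩ := Ext.contravariant_sequence_exact₁ hS _ (Ext.mk₀ (ModuleCat.ofHom φ)) rfl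
      (h.elim _ _)
    obtain ⟨ψ, rfl⟩ := (Ext.mk₀_bijective _ _).2 x
    rw [Ext.mk₀_comp_mk₀] at hx
    exact ⟨ψ.hom, congrArg ModuleCat.Hom.hom ((Ext.mk₀_bijective _ _).1 hx)⟩
  · obtain ⟨x, rfl⟩ := precomp_extClass_surjective_of_projective_X₂ _ hS 0 e
    obtain ⟨φ, rfl⟩ := (Ext.mk₀_bijective _ _).2 x
    obtain ⟨ψ, hψ⟩ := h φ.hom
    obtain rfl : ModuleCat.ofHom (LinearMap.ker p).subtype ≫ ModuleCat.ofHom ψ = φ :=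
      ModuleCat.hom_ext hψ
    rw [← Ext.mk₀_comp_mk₀]
    exact hS.extClass_comp_assoc _ (h := add_comm 1 0)

theorem subsingleton_ext_one_iff_of_exact (hp : Surjective p) (hd₁ : Exact d₁ p)
    (hd₂ : Exact d₂ d₁) :
    Subsingleton (Ext.{u} (ModuleCat.of R N) (ModuleCat.of R M) 1) ↔
      ∀ φ : F₁ →ₗ[R] M, φ ∘ₗ d₂ = 0 → ∃ ψ : F₀ →ₗ[R] M, ψ ∘ₗ d₁ = φ := by
  rw [subsingleton_ext_one_iff_of_projective hp]
  let π : F₁ →ₗ[R] LinearMap.ker p := d₁.codRestrict _ hd₁.apply_apply_eq_zero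
  have hπ : Surjective π := fun ⟨x, hx⟩ => ((hd₁ x).1 hx).imp fun _ hy => Subtype.ext hy
  have hdπ : Exact d₂ π := fun x => by rw [← hd₂ x]; exact Subtype.ext_iff
  refine ⟨fun h φ hφ => ?_, fun h φ => ?_⟩
  · obtain ⟨φ', rfl⟩ := (LinearMap.exact_lcomp_of_exact_of_surjective M hdπ hπ φ).1 hφ
    obtain ⟨ψ, rfl⟩ := h φ'
    exact ⟨ψ, rfl⟩
  · obtain ⟨ψ, hψ⟩ := h (φ ∘ₗ π)
      (by rw [LinearMap.comp_assoc, hdπ.linearMap_comp_eq_zero, LinearMap.comp_zero])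
    exact ⟨ψ, (LinearMap.cancel_right hπ).1 hψ⟩

theorem subsingleton_ext_add_two_iff_of_projective (hp : Surjective p) (i : ℕ) :
    Subsingleton (Ext.{u} (ModuleCat.of R N) (ModuleCat.of R M) (i + 2)) ↔
      Subsingleton (Ext.{u} (ModuleCat.of R (LinearMap.ker p)) (ModuleCat.of R M) (i + 1)) := by
  have hS := LinearMap.shortExact_shortComplexKer hp
  refine ⟨fun h => subsingleton_of_forall_eq 0 fun e => ?_, fun h => ?_⟩
  · obtain ⟨x, rfl⟩ := Ext.contravariant_sequence_exact₁ hS _ e (add_comm 1 _) (h.elim _ _)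
    rw [Ext.eq_zero_of_projective x, Ext.comp_zero]
  · exact (precomp_extClass_surjective_of_projective_X₂ _ hS (i + 1)).subsingleton

end Presentation

end Ext


namespace InitiallyRegular

open MvPolynomial Matrix MonomialOrder

section Multigraded

variable {σ R : Type*} [CommSemiring R] {ι κ : Type*}

/-- The component of multidegree `γ` of a vector in the free module with basis elements of
multidegrees `d j`, so that the monomial `xᵉ` in the `j`-th coordinate has multidegree `e + d j`. -/
noncomputable def multidegreePart (d : ι → σ →₀ ℕ) (γ : σ →₀ ℕ) (v : ι → MvPolynomial σ R) :
    ι → MvPolynomial σ R :=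
  open Classical in
  fun j => if d j ≤ γ then monomial (γ - d j) (coeff (γ - d j) (v j)) else 0

open Classical in
theorem coeff_multidegreePart (d : ι → σ →₀ ℕ) (γ : σ →₀ ℕ) (v : ι → MvPolynomial σ R) (j : ι)
    (e : σ →₀ ℕ) :
    coeff e (multidegreePart d γ v j) = if e + d j = γ then coeff e (v j) else 0 := by
  unfold multidegreePart
  by_cases hd : d j ≤ γ
  · simp only [if_pos hd, coeff_monomial, tsub_eq_iff_eq_add_of_le hd, eq_comm (a := γ)]
    split_ifs with he
    · rw [← he, add_tsub_cancel_right]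
    · rfl
  · have he : e + d j ≠ γ := fun he => hd (he ▸ le_add_self)
    simp [hd, he]

theorem multidegreePart_idem (d : ι → σ →₀ ℕ) (γ : σ →₀ ℕ) (v : ι → MvPolynomial σ R) :
    multidegreePart d γ (multidegreePart d γ v) = multidegreePart d γ v := by
  classical
  ext j e
  simp only [coeff_multidegreePart]
  split_ifs <;> rfl

theorem multidegreePart_sub {R : Type*} [CommRing R] (d : ι → σ →₀ ℕ) (γ : σ →₀ ℕ)
    (v w : ι → MvPolynomial σ R) :
    multidegreePart d γ (v - w) = multidegreePart d γ v - multidegreePart d γ w := by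
  classical
  ext j e
  simp only [coeff_multidegreePart, Pi.sub_apply, coeff_sub]
  split_ifs <;> simp

theorem exists_sum_multidegreePart_eq [Finite ι] (d : ι → σ →₀ ℕ) (v : ι → MvPolynomial σ R) :
    ∃ T : Finset (σ →₀ ℕ), ∑ γ ∈ T, multidegreePart d γ v = v := by
  classical
  cases nonempty_fintype ι
  refine ⟨Finset.univ.biUnion fun j => (v j).support.image (· + d j), ?_⟩
  ext j e
  simp only [Finset.sum_apply, coeff_sum, coeff_multidegreePart, Finset.sum_ite_eq,
    Finset.mem_biUnion, Finset.mem_univ, Finset.mem_image, true_and, ite_eq_left_iff]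
  intro hT
  by_contra he
  exact hT ⟨j, e, mem_support_iff.2 (Ne.symm he), rfl⟩

/-- The matrix `P` describes a morphism of multigraded free modules, from the one with basis
elements of multidegrees `c j` to the one with basis elements of multidegrees `r i`. -/
def IsMultigraded (r : ι → σ →₀ ℕ) (c : κ → σ →₀ ℕ) (P : Matrix ι κ (MvPolynomial σ R)) : Prop :=
  ∀ i j e, coeff e (P i j) ≠ 0 → e + r i = c j

/-- A submodule of a multigraded free module which is closed under taking components. -/
def IsMultihomogeneous (d : ι → σ →₀ ℕ)
    (K : Submodule (MvPolynomial σ R) (ι → MvPolynomial σ R)) : Prop :=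
  ∀ v ∈ K, ∀ γ, multidegreePart d γ v ∈ K

section Matrix

variable {r : ι → σ →₀ ℕ} {c : κ → σ →₀ ℕ} {P : Matrix ι κ (MvPolynomial σ R)}

theorem IsMultigraded.mulVec_multidegreePart [Fintype κ] (hP : IsMultigraded r c P) (γ : σ →₀ ℕ)
    (v : κ → MvPolynomial σ R) :
    P *ᵥ multidegreePart c γ v = multidegreePart r γ (P *ᵥ v) := by
  classical
  ext i e
  have hterm (j : κ) (x) (hx : x ∈ Finset.HasAntidiagonal.antidiagonal e) :
      coeff x.1 (P i j) * coeff x.2 (multidegreePart c γ v j) =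
        if e + r i = γ then coeff x.1 (P i j) * coeff x.2 (v j) else 0 := by
    by_cases hPx : coeff x.1 (P i j) = 0
    · simp [hPx]
    · rw [coeff_multidegreePart, ← hP i j x.1 hPx, ← Finset.HasAntidiagonal.mem_antidiagonal.1 hx,
        ← add_assoc, add_comm x.2, mul_ite, mul_zero]
  simp only [coeff_multidegreePart r, mulVec, dotProduct, coeff_sum, coeff_mul,
    Finset.sum_congr rfl (hterm _)]
  split_ifs <;> simp

-- The dual basis has multidegrees `-r i` and `-c j`, shifted here by `N` to stay in `ℕ`.
theorem IsMultigraded.transpose {N : σ →₀ ℕ} (hP : IsMultigraded r c P) (hc : ∀ j, c j ≤ N) :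
    IsMultigraded (fun j => N - c j) (fun i => N - r i) Pᵀ := by
  intro j i e he
  ext x
  have hdeg := DFunLike.congr_fun (hP i j e he) x
  have hN := hc j x
  simp only [Finsupp.add_apply, Finsupp.tsub_apply] at hdeg ⊢
  lia

theorem IsMultigraded.isMultihomogeneous_ker [Fintype κ] (hP : IsMultigraded r c P) :
    IsMultihomogeneous c (LinearMap.ker P.mulVecLin) := by
  classical
  intro v hv γ
  simp only [LinearMap.mem_ker, mulVecLin_apply] at hv ⊢
  rw [hP.mulVec_multidegreePart, hv]
  ext; simp [coeff_multidegreePart]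

end Matrix

theorem IsMultihomogeneous.span_multidegreePart [Finite ι] {d : ι → σ →₀ ℕ}
    {K : Submodule (MvPolynomial σ R) (ι → MvPolynomial σ R)} (hK : IsMultihomogeneous d K) :
    Submodule.span (MvPolynomial σ R) {v ∈ K | ∃ γ, multidegreePart d γ v = v} = K := by
  refine le_antisymm (Submodule.span_le.2 fun v hv => hv.1) fun v hv => ?_
  obtain ⟨T, hT⟩ := exists_sum_multidegreePart_eq d v
  rw [← hT]
  exact Submodule.sum_mem _ fun γ _ =>
    Submodule.subset_span ⟨hK v hv γ, γ, multidegreePart_idem d γ v⟩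

theorem IsMultihomogeneous.exists_isMultigraded_range_eq {R : Type*} [CommRing R]
    [IsNoetherianRing R] [Finite σ] [Finite ι] {d : ι → σ →₀ ℕ}
    {K : Submodule (MvPolynomial σ R) (ι → MvPolynomial σ R)} (hK : IsMultihomogeneous d K) :
    ∃ (s : Finset (ι → MvPolynomial σ R)) (c : s → σ →₀ ℕ) (P : Matrix ι s (MvPolynomial σ R)),
      IsMultigraded d c P ∧ LinearMap.range P.mulVecLin = K := by
  classical
  obtain ⟨s, hs, hspan⟩ := (Submodule.fg_span_iff_fg_span_finset_subset _).1
    (IsNoetherian.noetherian (Submodule.span (MvPolynomial σ R)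
      {v ∈ K | ∃ γ, multidegreePart d γ v = v}))
  choose c hc using fun v : s => (hs v.2).2
  refine ⟨s, c, .of fun i v => v.1 i, fun i v e he => ?_, ?_⟩
  · rw [of_apply, ← hc v, coeff_multidegreePart] at he
    exact of_not_not fun h => he (if_neg h)
  · rw [range_mulVecLin, ← hK.span_multidegreePart, hspan]
    congr 1
    exact Subtype.range_coe

end Multigraded

section MonomialIdeal

variable {σ R : Type*} [CommSemiring R] {ι : Type*}

/-- A monomial ideal, characterised as one which contains every term of each of its elements. -/
def IsMonomialIdeal (𝔞 : Ideal (MvPolynomial σ R)) : Prop :=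
  ∀ p ∈ 𝔞, ∀ e, monomial e (coeff e p) ∈ 𝔞

theorem isMonomialIdeal_span_monomial (s : Set (σ →₀ ℕ)) :
    IsMonomialIdeal (Ideal.span ((fun e => monomial e (1 : R)) '' s)) := by
  classical
  intro p hp e
  rw [mem_ideal_span_monomial_image] at hp ⊢
  intro a ha
  obtain rfl : a = e := Finset.mem_singleton.1 (support_monomial_subset ha)
  exact hp a (by simpa using ha)

theorem isMonomialIdeal_idealOfVars : IsMonomialIdeal (idealOfVars σ R) := by
  have : idealOfVars σ R =
      Ideal.span ((fun e => monomial e (1 : R)) '' Set.range fun i => Finsupp.single i 1) := by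
    rw [← Set.range_comp]; rfl
  exact this ▸ isMonomialIdeal_span_monomial _

theorem IsMonomialIdeal.multidegreePart_mem {𝔞 : Ideal (MvPolynomial σ R)}
    (h𝔞 : IsMonomialIdeal 𝔞) {d : ι → σ →₀ ℕ} {γ : σ →₀ ℕ} {v : ι → MvPolynomial σ R} {j : ι}
    (hv : v j ∈ 𝔞) :
    multidegreePart d γ v j ∈ 𝔞 := by
  unfold multidegreePart
  split_ifs
  · exact h𝔞 _ hv _
  · exact 𝔞.zero_mem

end MonomialIdeal

section Ini

variable {k : Type u} [Field k] {n : ℕ} {ord : MonomialOrder.{0, v} (Fin n)}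
  {I : Ideal (MvPolynomial (Fin n) k)}

theorem ini_eq_span_monomial_degree (ord : MonomialOrder.{0, v} (Fin n))
    (I : Ideal (MvPolynomial (Fin n) k)) :
    ini ord I = Ideal.span ((fun e => monomial e (1 : k)) ''
      (ord.degree '' ((I : Set (MvPolynomial (Fin n) k)) \ {0}))) := by
  rw [ini, MonomialOrder.span_leadingTerm_eq_span_monomial', Set.image_image]

theorem isMonomialIdeal_ini (ord : MonomialOrder.{0, v} (Fin n))
    (I : Ideal (MvPolynomial (Fin n) k)) : IsMonomialIdeal (ini ord I) :=
  ini_eq_span_monomial_degree ord I ▸ isMonomialIdeal_span_monomial _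

theorem monomial_mem_ini_iff_of_ne_zero {b : Fin n →₀ ℕ} {c : k} (hc : c ≠ 0) :
    monomial b c ∈ ini ord I ↔ ∃ g ∈ I, g ≠ 0 ∧ ord.degree g ≤ b := by
  classical
  rw [ini_eq_span_monomial_degree, mem_ideal_span_monomial_image]
  simp [support_monomial, hc, and_assoc]

theorem monomial_mem_ini_iff {b : Fin n →₀ ℕ} {c : k} :
    monomial b c ∈ ini ord I ↔ ∃ g ∈ I, coeff b g = c ∧ ord.degree g ≼[ord] b := by
  by_cases hc : c = 0
  · simpa [hc] using ⟨0, I.zero_mem, by simp, by simp⟩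
  rw [monomial_mem_ini_iff_of_ne_zero hc]
  constructor
  · rintro ⟨g, hgI, hg, hb⟩
    obtain ⟨d, rfl⟩ := exists_add_of_le hb
    refine ⟨g * monomial d (c / ord.leadingCoeff g), I.mul_mem_right _ hgI, ?_, ?_⟩
    · rw [coeff_mul_monomial]
      exact mul_div_cancel₀ c (ord.leadingCoeff_ne_zero_iff.2 hg)
    · refine ord.degree_mul_le.trans ?_
      rw [map_add, map_add]
      gcongr
      exact ord.degree_monomial_le _
  · rintro ⟨g, hgI, rfl, hb⟩
    refine ⟨g, hgI, fun hg => hc (by simp [hg]), ?_⟩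
    exact (ord.toSyn.injective (hb.antisymm (ord.le_degree (mem_support_iff.2 hc)))).le

end Ini

section TopDegree

variable {σ R : Type*} [CommSemiring R] {ι κ : Type*} [Fintype ι] [Fintype κ]
  {ord : MonomialOrder σ} {d : ι → σ →₀ ℕ}

/-- The largest multidegree, for the term order `ord`, of a term of a vector in the free module
with basis elements of multidegrees `d j`; it is `⊥` for the zero vector. -/
noncomputable def topDegree (ord : MonomialOrder σ) (d : ι → σ →₀ ℕ)
    (v : ι → MvPolynomial σ R) : WithBot ord.syn :=
  Finset.univ.sup fun j => (v j).support.sup fun e => (ord.toSyn (e + d j) : WithBot ord.syn)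

theorem topDegree_le_iff {v : ι → MvPolynomial σ R} {s : WithBot ord.syn} :
    topDegree ord d v ≤ s ↔ ∀ j e, coeff e (v j) ≠ 0 → ord.toSyn (e + d j) ≤ s := by
  simp [topDegree]

theorem topDegree_lt_of_multidegreePart_eq_zero {v : ι → MvPolynomial σ R} {γ : σ →₀ ℕ}
    (hv : topDegree ord d v ≤ ord.toSyn γ) (hγ : multidegreePart d γ v = 0) :
    topDegree ord d v < ord.toSyn γ := by
  classical
  refine (Finset.sup_lt_iff (WithBot.bot_lt_coe _)).2 fun j _ =>
    (Finset.sup_lt_iff (WithBot.bot_lt_coe _)).2 fun e he => ?_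
  rw [mem_support_iff] at he
  refine (topDegree_le_iff.1 hv j e he).lt_of_ne fun heq => he ?_
  have hdeg : e + d j = γ := ord.toSyn.injective (WithBot.coe_injective heq)
  simpa [coeff_multidegreePart, hdeg] using congr_arg (coeff e) (congr_fun hγ j)

theorem topDegree_multidegreePart_le (γ : σ →₀ ℕ) (v : ι → MvPolynomial σ R) :
    topDegree ord d (multidegreePart d γ v) ≤ ord.toSyn γ := by
  classical
  refine topDegree_le_iff.2 fun j e he => ?_
  rw [coeff_multidegreePart] at he
  rw [of_not_not fun h => he (if_neg h)]

theorem topDegree_sub_le {R : Type*} [CommRing R] {v w : ι → MvPolynomial σ R} {s : WithBot ord.syn}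
    (hv : topDegree ord d v ≤ s) (hw : topDegree ord d w ≤ s) :
    topDegree ord d (v - w) ≤ s := by
  refine topDegree_le_iff.2 fun j e he => ?_
  by_cases hve : coeff e (v j) = 0
  · exact topDegree_le_iff.1 hw j e fun hwe => he (by simp [hve, hwe])
  · exact topDegree_le_iff.1 hv j e hve

theorem IsMultigraded.topDegree_mulVec_le {r : ι → σ →₀ ℕ} {c : κ → σ →₀ ℕ}
    {P : Matrix ι κ (MvPolynomial σ R)} (hP : IsMultigraded r c P) (v : κ → MvPolynomial σ R) :
    topDegree ord r (P *ᵥ v) ≤ topDegree ord c v := by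
  classical
  refine topDegree_le_iff.2 fun i e he => ?_
  simp only [mulVec, dotProduct, coeff_sum, coeff_mul] at he
  obtain ⟨j, -, hj⟩ := Finset.exists_ne_zero_of_sum_ne_zero he
  obtain ⟨⟨a, b⟩, hab, hx⟩ := Finset.exists_ne_zero_of_sum_ne_zero hj
  have hdeg : e + r i = b + c j := by
    rw [← Finset.HasAntidiagonal.mem_antidiagonal.1 hab, ← hP i j a (left_ne_zero_of_mul hx)]
    exact add_right_comm .. |>.trans (add_comm ..)
  exact hdeg ▸ topDegree_le_iff.1 le_rfl j b (right_ne_zero_of_mul hx)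

end TopDegree

section ExactMod

variable {S : Type*} [CommRing S] {A B C : Type*} [Fintype B] {J : Ideal S}

/-- The reduction modulo `J` of the pair of maps `D : S^A → S^B` and `E : S^B → S^C` is exact at
`S^B`, in the sense that cycles are boundaries; it is phrased in terms of lifts of the vectors to
`S`, and `E * D = 0` is not part of the definition. -/
def IsExactMod [Fintype A] (J : Ideal S) (D : Matrix B A S) (E : Matrix C B S) : Prop :=
  ∀ z : B → S, (∀ c, (E *ᵥ z) c ∈ J) → ∃ w : A → S, ∀ b, (z - D *ᵥ w) b ∈ J

theorem mulVec_apply_mem {z : B → S} (hz : ∀ b, z b ∈ J) (E : Matrix C B S) (c : C) :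
    (E *ᵥ z) c ∈ J :=
  J.sum_mem fun b _ => J.mul_mem_left _ (hz b)

theorem linearCombination_mkQ_comp_mulVecLin [Fintype A] (z : A → S) (P : Matrix A B S) :
    Fintype.linearCombination S (J.mkQ ∘ z) ∘ₗ P.mulVecLin =
      Fintype.linearCombination S (J.mkQ ∘ (Pᵀ *ᵥ z)) := by
  ext v
  simp only [LinearMap.comp_apply, mulVecLin_apply, Fintype.linearCombination_apply,
    Function.comp_apply, ← map_smul, ← map_sum, smul_eq_mul]
  refine congrArg J.mkQ ?_
  rw [← dotProduct, ← dotProduct, mulVec_transpose, dotProduct_comm, dotProduct_mulVec,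
    dotProduct_comm]

theorem linearCombination_mkQ_eq_iff {z z' : B → S} :
    Fintype.linearCombination S (J.mkQ ∘ z) = Fintype.linearCombination S (J.mkQ ∘ z') ↔
      ∀ b, (z - z') b ∈ J := by
  classical
  have hmk : (∀ b, (z - z') b ∈ J) ↔ J.mkQ ∘ z = J.mkQ ∘ z' :=
    (forall_congr' fun b => (Submodule.Quotient.eq J).symm).trans funext_iff.symm
  rw [hmk]
  refine ⟨fun h => funext fun b => ?_, fun h => h ▸ rfl⟩
  simpa using LinearMap.congr_fun h (Pi.single b 1)

theorem linearCombination_mkQ_eq_zero_iff {z : B → S} :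
    Fintype.linearCombination S (J.mkQ ∘ z) = 0 ↔ ∀ b, z b ∈ J := by
  have hzero : Fintype.linearCombination S (J.mkQ ∘ (0 : B → S)) = 0 := by
    ext; simp [Fintype.linearCombination_apply]
  rw [← hzero, linearCombination_mkQ_eq_iff, sub_zero]

theorem exists_linearCombination_mkQ_eq (φ : (B → S) →ₗ[S] S ⧸ J) :
    ∃ z : B → S, Fintype.linearCombination S (J.mkQ ∘ z) = φ := by
  classical
  choose z hz using fun b => J.mkQ_surjective (φ (Pi.single b 1))
  refine ⟨z, LinearMap.pi_ext' fun b => LinearMap.ext_ring ?_⟩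
  simpa using hz b

theorem forall_exists_comp_mulVecLin_eq_iff_isExactMod [Fintype A] [Fintype C]
    (P : Matrix A B S) (Q : Matrix B C S) :
    (∀ φ : (B → S) →ₗ[S] S ⧸ J, φ ∘ₗ Q.mulVecLin = 0 →
      ∃ ψ : (A → S) →ₗ[S] S ⧸ J, ψ ∘ₗ P.mulVecLin = φ) ↔ IsExactMod J Pᵀ Qᵀ := by
  refine ⟨fun h z hz => ?_, fun h φ hφ => ?_⟩
  · obtain ⟨ψ, hψ⟩ := h (Fintype.linearCombination S (J.mkQ ∘ z)) (by
      rw [linearCombination_mkQ_comp_mulVecLin, linearCombination_mkQ_eq_zero_iff.2 hz])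
    obtain ⟨w, rfl⟩ := exists_linearCombination_mkQ_eq ψ
    rw [linearCombination_mkQ_comp_mulVecLin, eq_comm] at hψ
    exact ⟨w, linearCombination_mkQ_eq_iff.1 hψ⟩
  · obtain ⟨z, rfl⟩ := exists_linearCombination_mkQ_eq φ
    rw [linearCombination_mkQ_comp_mulVecLin] at hφ
    obtain ⟨w, hw⟩ := h z (linearCombination_mkQ_eq_zero_iff.1 hφ)
    refine ⟨Fintype.linearCombination S (J.mkQ ∘ w), ?_⟩
    rw [linearCombination_mkQ_comp_mulVecLin, linearCombination_mkQ_eq_iff.2 hw]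

end ExactMod

section Descent

variable {k : Type u} [Field k] {n : ℕ} {ord : MonomialOrder.{0, v} (Fin n)}
  {I : Ideal (MvPolynomial (Fin n) k)} {ι : Type*} [Fintype ι] {d : ι → Fin n →₀ ℕ}
  {γ : Fin n →₀ ℕ} {v : ι → MvPolynomial (Fin n) k}

theorem multidegreePart_mem_ini (hv : ∀ j, v j ∈ I) (hγ : topDegree ord d v ≤ ord.toSyn γ)
    (j : ι) : multidegreePart d γ v j ∈ ini ord I := by
  unfold multidegreePart
  split_ifs with hj
  · refine monomial_mem_ini_iff.2 ⟨v j, hv j, rfl, ord.degree_le_iff.2 fun e he => ?_⟩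
    have hle := WithBot.coe_le_coe.1 (topDegree_le_iff.1 hγ j e (mem_support_iff.1 he))
    rwa [← tsub_add_cancel_of_le hj, map_add, map_add, add_le_add_iff_right] at hle
  · exact Ideal.zero_mem _

theorem exists_multidegreePart_eq_of_mem_ini (hv : ∀ j, multidegreePart d γ v j ∈ ini ord I) :
    ∃ g : ι → MvPolynomial (Fin n) k, (∀ j, g j ∈ I) ∧ topDegree ord d g ≤ ord.toSyn γ ∧
      multidegreePart d γ g = multidegreePart d γ v := by
  classical
  have hlift (j : ι) : ∃ p ∈ I, (∀ e, coeff e p ≠ 0 → ord.toSyn (e + d j) ≤ ord.toSyn γ) ∧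
      (d j ≤ γ → coeff (γ - d j) p = coeff (γ - d j) (v j)) := by
    by_cases hj : d j ≤ γ
    · have hmem := hv j
      rw [multidegreePart, if_pos hj] at hmem
      obtain ⟨p, hpI, hp, hdeg⟩ := monomial_mem_ini_iff.1 hmem
      refine ⟨p, hpI, fun e he => ?_, fun _ => hp⟩
      rw [← tsub_add_cancel_of_le hj, map_add, map_add]
      gcongr
      exact (ord.le_degree (mem_support_iff.2 he)).trans hdeg
    · exact ⟨0, I.zero_mem, by simp, fun h => absurd h hj⟩
  choose g hgI hdeg hcoeff using hlift
  refine ⟨g, hgI, topDegree_le_iff.2 fun j e he => WithBot.coe_le_coe.2 (hdeg j e he), ?_⟩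
  ext1 j
  unfold multidegreePart
  split_ifs with hj
  · rw [hcoeff j hj]
  · rfl

variable {A B C : Type*} [Fintype A] [Fintype B] [Finite C] {a : A → Fin n →₀ ℕ}
  {b : B → Fin n →₀ ℕ} {c : C → Fin n →₀ ℕ} {D : Matrix B A (MvPolynomial (Fin n) k)}
  {E : Matrix C B (MvPolynomial (Fin n) k)}

theorem IsExactMod.exists_topDegree_lt (hD : IsMultigraded b a D) (hE : IsMultigraded c b E)
    (hini : IsExactMod (ini ord I) D E) {z : B → MvPolynomial (Fin n) k}
    (hz : topDegree ord b z = ord.toSyn γ) (hEz : ∀ i, (E *ᵥ z) i ∈ I) :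
    ∃ (w : A → MvPolynomial (Fin n) k) (g : B → MvPolynomial (Fin n) k), (∀ j, g j ∈ I) ∧
      topDegree ord b (z - D *ᵥ w - g) < topDegree ord b z := by
  cases nonempty_fintype C
  have hEγ : ∀ i, (E *ᵥ multidegreePart b γ z) i ∈ ini ord I := by
    rw [hE.mulVec_multidegreePart]
    exact multidegreePart_mem_ini hEz ((hE.topDegree_mulVec_le z).trans hz.le)
  obtain ⟨w, hw⟩ := hini _ hEγ
  have hγ : multidegreePart b γ (multidegreePart b γ z - D *ᵥ w) =
      multidegreePart b γ (z - D *ᵥ multidegreePart a γ w) := by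
    rw [multidegreePart_sub, multidegreePart_sub, multidegreePart_idem,
      hD.mulVec_multidegreePart, multidegreePart_idem]
  obtain ⟨g, hgI, hgdeg, hg⟩ := exists_multidegreePart_eq_of_mem_ini (I := I) (ord := ord)
    (d := b) (γ := γ) fun j => (isMonomialIdeal_ini ord I).multidegreePart_mem (hw j)
  refine ⟨multidegreePart a γ w, g, hgI, ?_⟩
  rw [hz]
  refine topDegree_lt_of_multidegreePart_eq_zero (topDegree_sub_le (topDegree_sub_le hz.le ?_)
    hgdeg) ?_
  · exact (hD.topDegree_mulVec_le _).trans (topDegree_multidegreePart_le γ w)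
  · rw [multidegreePart_sub, ← hγ, hg, sub_self]

theorem IsExactMod.of_ini (hD : IsMultigraded b a D) (hE : IsMultigraded c b E) (hED : E * D = 0)
    (hini : IsExactMod (ini ord I) D E) : IsExactMod I D E := by
  intro z
  induction hs : topDegree ord b z using WellFoundedLT.induction generalizing z with
  | ind s ih =>
  intro hEz
  induction s with
  | bot =>
    refine ⟨0, fun j => ?_⟩
    have hzj : z j = 0 := by
      ext e
      by_contra he
      simpa using topDegree_le_iff.1 hs.le j e he
    simp [hzj]
  | coe s =>
    obtain ⟨γ, rfl⟩ := ord.toSyn.surjective s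
    obtain ⟨w, g, hgI, hlt⟩ := hini.exists_topDegree_lt hD hE hs hEz
    obtain ⟨w', hw'⟩ := ih _ (hs ▸ hlt) (z - D *ᵥ w - g) rfl fun i => by
      rw [mulVec_sub, mulVec_sub, mulVec_mulVec, hED, zero_mulVec, sub_zero]
      exact I.sub_mem (hEz i) (mulVec_apply_mem hgI E i)
    refine ⟨w + w', fun j => ?_⟩
    convert I.add_mem (hw' j) (hgI j) using 1
    simp only [mulVec_add, Pi.sub_apply, Pi.add_apply]
    ring

end Descent

section ExtIni

open CategoryTheory Abelian

variable {k : Type u} [Field k] {n : ℕ}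

theorem IsExactMod.transpose_of_ini {A B C : Type*} [Fintype A] [Fintype B] [Finite C]
    {ord : MonomialOrder.{0, v} (Fin n)} {I : Ideal (MvPolynomial (Fin n) k)}
    {a : A → Fin n →₀ ℕ} {b : B → Fin n →₀ ℕ} {c : C → Fin n →₀ ℕ}
    {P : Matrix A B (MvPolynomial (Fin n) k)} {Q : Matrix B C (MvPolynomial (Fin n) k)}
    (hP : IsMultigraded a b P) (hQ : IsMultigraded b c Q) (hPQ : P * Q = 0)
    (hini : IsExactMod (ini ord I) Pᵀ Qᵀ) : IsExactMod I Pᵀ Qᵀ := by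
  obtain ⟨N, hN⟩ := (Set.finite_range (Sum.elim b c)).bddAbove
  have hbN (i) : b i ≤ N := hN ⟨.inl i, rfl⟩
  have hcN (i) : c i ≤ N := hN ⟨.inr i, rfl⟩
  refine hini.of_ini (hP.transpose hbN) (hQ.transpose hcN) ?_
  rw [← transpose_mul, hPQ, transpose_zero]

variable {B N : Type u} [Finite B] [AddCommGroup N] [Module (MvPolynomial (Fin n) k) N]
  {d : B → Fin n →₀ ℕ} {p : (B → MvPolynomial (Fin n) k) →ₗ[MvPolynomial (Fin n) k] N}
  {ord : MonomialOrder.{0, v} (Fin n)} {I : Ideal (MvPolynomial (Fin n) k)}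

theorem subsingleton_ext_zero_of_ini (hp : Function.Surjective p)
    (hker : IsMultihomogeneous d (LinearMap.ker p))
    (hini : Subsingleton (Ext.{u} (ModuleCat.of (MvPolynomial (Fin n) k) N)
      (ModuleCat.of _ (MvPolynomial (Fin n) k ⧸ ini ord I)) 0)) :
    Subsingleton (Ext.{u} (ModuleCat.of (MvPolynomial (Fin n) k) N)
      (ModuleCat.of _ (MvPolynomial (Fin n) k ⧸ I)) 0) := by
  cases nonempty_fintype B
  obtain ⟨s, c, P, hP, hPK⟩ := hker.exists_isMultigraded_range_eq
  have hex : Function.Exact P.mulVecLin p := LinearMap.exact_iff.2 hPK.symm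
  rw [subsingleton_ext_zero_iff_of_exact hp hex] at hini ⊢
  -- Injectivity is exactness of a complex that starts with the free module of rank zero.
  have hzero (J : Ideal (MvPolynomial (Fin n) k)) :
      (∀ φ : (B → MvPolynomial (Fin n) k) →ₗ[MvPolynomial (Fin n) k] MvPolynomial (Fin n) k ⧸ J,
        φ ∘ₗ P.mulVecLin = 0 → φ = 0) ↔ IsExactMod J (0 : Matrix Empty B _)ᵀ Pᵀ := by
    simp only [← forall_exists_comp_mulVecLin_eq_iff_isExactMod, mulVecLin_zero,
      LinearMap.comp_zero, exists_const, eq_comm]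
  have hgr : IsMultigraded Empty.elim d (0 : Matrix Empty B (MvPolynomial (Fin n) k)) := nofun
  exact (hzero I).2 (((hzero _).1 hini).transpose_of_ini hgr hP (Matrix.zero_mul P))

theorem subsingleton_ext_one_of_ini (hp : Function.Surjective p)
    (hker : IsMultihomogeneous d (LinearMap.ker p))
    (hini : Subsingleton (Ext.{u} (ModuleCat.of (MvPolynomial (Fin n) k) N)
      (ModuleCat.of _ (MvPolynomial (Fin n) k ⧸ ini ord I)) 1)) :
    Subsingleton (Ext.{u} (ModuleCat.of (MvPolynomial (Fin n) k) N)
      (ModuleCat.of _ (MvPolynomial (Fin n) k ⧸ I)) 1) := by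
  cases nonempty_fintype B
  obtain ⟨s, c, P, hP, hPK⟩ := hker.exists_isMultigraded_range_eq
  have hex : Function.Exact P.mulVecLin p := LinearMap.exact_iff.2 hPK.symm
  obtain ⟨t, e, Q, hQ, hQK⟩ := hP.isMultihomogeneous_ker.exists_isMultigraded_range_eq
  have hex' : Function.Exact Q.mulVecLin P.mulVecLin := LinearMap.exact_iff.2 hQK.symm
  rw [subsingleton_ext_one_iff_of_exact hp hex hex',
    forall_exists_comp_mulVecLin_eq_iff_isExactMod] at hini ⊢
  have hPQ : P * Q = 0 := by
    classical
    refine toLin'.injective ?_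
    rw [toLin'_apply', mulVecLin_mul, hex'.linearMap_comp_eq_zero, map_zero]
  exact hini.transpose_of_ini hP hQ hPQ

theorem subsingleton_ext_of_ini (i : ℕ) (hp : Function.Surjective p)
    (hker : IsMultihomogeneous d (LinearMap.ker p))
    (hini : Subsingleton (Ext.{u} (ModuleCat.of (MvPolynomial (Fin n) k) N)
      (ModuleCat.of _ (MvPolynomial (Fin n) k ⧸ ini ord I)) i)) :
    Subsingleton (Ext.{u} (ModuleCat.of (MvPolynomial (Fin n) k) N)
      (ModuleCat.of _ (MvPolynomial (Fin n) k ⧸ I)) i) := by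
  induction i using Nat.twoStepInduction generalizing B N with
  | zero => exact subsingleton_ext_zero_of_ini hp hker hini
  | one => exact subsingleton_ext_one_of_ini hp hker hini
  | more i _ ih =>
    rw [subsingleton_ext_add_two_iff_of_projective hp] at hini ⊢
    obtain ⟨s, c, P, hP, hPK⟩ := hker.exists_isMultigraded_range_eq
    let π := P.mulVecLin.codRestrict (LinearMap.ker p) fun v => hPK ▸ ⟨v, rfl⟩
    have hπ : Function.Surjective π := fun ⟨x, hx⟩ =>
      (hPK ▸ hx : x ∈ LinearMap.range P.mulVecLin).imp fun _ hy => Subtype.ext hy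
    have hπker : LinearMap.ker π = LinearMap.ker P.mulVecLin := LinearMap.ker_codRestrict ..
    exact ih hπ (hπker ▸ hP.isMultihomogeneous_ker) hini

theorem moduleDepth_ini_le {𝔞 : Ideal (MvPolynomial (Fin n) k)} (h𝔞 : IsMonomialIdeal 𝔞)
    (ord : MonomialOrder.{0, v} (Fin n)) (I : Ideal (MvPolynomial (Fin n) k)) :
    moduleDepth 𝔞 (MvPolynomial (Fin n) k ⧸ ini ord I) ≤
      moduleDepth 𝔞 (MvPolynomial (Fin n) k ⧸ I) := by
  let p : (PUnit.{u + 1} → MvPolynomial (Fin n) k) →ₗ[MvPolynomial (Fin n) k] _ :=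
    𝔞.mkQ ∘ₗ LinearMap.proj PUnit.unit
  have hp : Function.Surjective p :=
    𝔞.mkQ_surjective.comp (LinearMap.proj_surjective _)
  have hmem (v) : v ∈ LinearMap.ker p ↔ v PUnit.unit ∈ 𝔞 := Submodule.Quotient.mk_eq_zero 𝔞
  have hker : IsMultihomogeneous 0 (LinearMap.ker p) := fun v hv γ =>
    (hmem _).2 (h𝔞.multidegreePart_mem ((hmem v).1 hv))
  refine ENat.forall_natCast_le_iff_le.1 fun q hq => natCast_le_moduleDepth_iff.2 fun i hi => ?_
  exact subsingleton_ext_of_ini i hp hker (natCast_le_moduleDepth_iff.1 hq i hi)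

end ExtIni

section InitiallyRegularSequence

variable {k : Type u} [Field k] {n q : ℕ} {I 𝔞 : Ideal (MvPolynomial (Fin n) k)}
  {ord : Fin q → MonomialOrder.{0, v} (Fin n)} {f : Fin q → MvPolynomial (Fin n) k}

theorem moduleDepth_iniSeq_succ_add_one_le (h𝔞 : IsMonomialIdeal 𝔞) {i : ℕ} (hi : i + 1 < q)
    (hmem : f ⟨i, Nat.lt_of_succ_lt hi⟩ ∈ 𝔞)
    (hreg : IsSMulRegular (MvPolynomial (Fin n) k ⧸ iniSeq I ord f i (Nat.lt_of_succ_lt hi))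
      (f ⟨i, Nat.lt_of_succ_lt hi⟩)) :
    moduleDepth 𝔞 (MvPolynomial (Fin n) k ⧸ iniSeq I ord f (i + 1) hi) + 1 ≤
      moduleDepth 𝔞 (MvPolynomial (Fin n) k ⧸ iniSeq I ord f i (Nat.lt_of_succ_lt hi)) :=
  (add_left_mono (moduleDepth_ini_le h𝔞 ..)).trans
    (moduleDepth_quotient_sup_span_add_one_le hmem hreg)

theorem natCast_add_one_le_moduleDepth_iniSeq (h𝔞 : IsMonomialIdeal 𝔞) (hmem : ∀ i, f i ∈ 𝔞)
    (hreg : ∀ i : Fin q, IsSMulRegular (MvPolynomial (Fin n) k ⧸ iniSeq I ord f i i.isLt) (f i))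
    {i j : ℕ} (hi : i < q) (hij : i + j < q) :
    (j : ℕ∞) + 1 ≤ moduleDepth 𝔞 (MvPolynomial (Fin n) k ⧸ iniSeq I ord f i hi) := by
  induction j generalizing i with
  | zero =>
    exact (add_left_mono bot_le).trans
      (moduleDepth_quotient_sup_span_add_one_le (hmem ⟨i, hi⟩) (hreg ⟨i, hi⟩))
  | succ j ih =>
    have hi' : i + 1 < q := by lia
    have hnext := ih hi' (by lia)
    rw [Nat.cast_succ]
    exact (add_left_mono hnext).trans
      (moduleDepth_iniSeq_succ_add_one_le h𝔞 hi' (hmem ⟨i, hi⟩) (hreg ⟨i, hi⟩))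

end InitiallyRegularSequence

end InitiallyRegular

theorem proposition2p2_general {k : Type u} [Field k] {n q : ℕ}
    {𝔞 : Ideal (MvPolynomial (Fin n) k)} (h𝔞 : InitiallyRegular.IsMonomialIdeal 𝔞)
    (I : Ideal (MvPolynomial (Fin n) k)) (ord : Fin q → MonomialOrder.{0, v} (Fin n))
    (f : Fin q → MvPolynomial (Fin n) k) (hmem : ∀ i, f i ∈ 𝔞)
    (hreg : ∀ i : Fin q, IsSMulRegular
      (MvPolynomial (Fin n) k ⧸ InitiallyRegular.iniSeq I ord f i i.isLt) (f i)) :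
    (q : ℕ∞) ≤ moduleDepth 𝔞 (MvPolynomial (Fin n) k ⧸ I) := by
  cases q with
  | zero => simp
  | succ q =>
    have hdepth := InitiallyRegular.natCast_add_one_le_moduleDepth_iniSeq h𝔞 hmem hreg
      (j := q) q.succ_pos (by lia)
    rw [Nat.cast_succ]
    exact hdepth.trans (InitiallyRegular.moduleDepth_ini_le h𝔞 ..)

theorem proposition2p2 {k : Type u} [Field k] {n q : ℕ} (I : Ideal (MvPolynomial (Fin n) k))
    (ord : Fin q → MonomialOrder.{0, v} (Fin n)) (f : Fin q → MvPolynomial (Fin n) k)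
    (hf : InitiallyRegular.IsInitiallyRegular I ord f) :
    (q : ℕ∞) ≤ moduleDepth (MvPolynomial.idealOfVars (Fin n) k) (MvPolynomial (Fin n) k ⧸ I) :=
  proposition2p2_general InitiallyRegular.isMonomialIdeal_idealOfVars I ord f
    (fun i => (hf.regular i).1) fun i => (hf.regular i).2
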